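/- Let $M$ be a surface (a $2$-dimensional manifold without boundary, with a $C^2$ structure) and let $f:M\to M$ be a $C^2$-diffeomorphism. Let $z_0$ be a fixed point of $f$ that is a saddle-node, i.e. one of the two eigenvalues of $Df(z_0)$ is $1$ and the other one is not; suppose moreover that the other eigenvalue is not $-1$, that $z_0$ is an isolated fixed point, and that its Lefschetz index is $0$ (that is, in the preferred local coordinates at $z_0$, the vector field $w\mapsto f(w)-w$ has winding number $0$ along every sufficiently small circle centred at $z_0$). Then $z_0$ is trivializable: there is a homeomorphism $h:U\to V$ from an open neighbourhood $U$ of $z_0$ in $M$ onto an open set $V\subset\mathbb{R}^2$ such that $$p_1(h(f(z)))>p_1(h(z))\qquad\text{for every } z\in U\cap f^{-1}(U) \text{ with } z\neq z_0,$$ where $p_1(x,y)=x$. -/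

import Mathlib

open scoped Manifold ContDiff Topology

noncomputable section

/-- The plane `ℝ²`, on which surfaces are modelled. -/
abbrev Plane : Type := EuclideanSpace ℝ (Fin 2)

/-- The point `c + r (cos θ, sin θ)` of the circle of centre `c` and radius `r`. -/
def circlePoint (c : Plane) (r θ : ℝ) : Plane :=
  c + r • !₂[Real.cos θ, Real.sin θ]

/-- The loop `γ : [0, 2π] → ℝ² ∖ {0}`, given as a function on `ℝ` (in the use below it is
`2π`-periodic), has winding number `n` around the origin: it is continuous, it does not vanish,
and its argument has a continuous determination `a` that increases by `2πn` along the loop. -/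
def HasWindingNumber (γ : ℝ → Plane) (n : ℤ) : Prop :=
  Continuous γ ∧ (∀ t, γ t ≠ 0) ∧
    ∃ a : ℝ → ℝ, Continuous a ∧
      (∀ t, γ t = ‖γ t‖ • !₂[Real.cos (a t), Real.sin (a t)]) ∧
      a (2 * Real.pi) = a 0 + 2 * Real.pi * n

section Surface

variable {M : Type*} [TopologicalSpace M] [ChartedSpace Plane M]

/-- `z₀` is an isolated fixed point of `f`. -/
def IsIsolatedFixedPoint {N : Type*} [TopologicalSpace N] (f : N → N) (z₀ : N) : Prop :=
  f z₀ = z₀ ∧ ∀ᶠ z in 𝓝[≠] z₀, f z ≠ z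

/-- The isolated fixed point `z₀` of `f` has Lefschetz index `n`: with `F` the expression of `f`
in the preferred chart at `z₀` and `c` the coordinate of `z₀`, the vector field
`w ↦ F w - w` has winding number `n` along every small enough circle centred at `c`. -/
def HasLefschetzIndex (f : M → M) (z₀ : M) (n : ℤ) : Prop :=
  IsIsolatedFixedPoint f z₀ ∧
    ∀ᶠ r : ℝ in 𝓝[>] 0,
      HasWindingNumber
        (fun θ => chartAt Plane z₀
              (f ((chartAt Plane z₀).symm (circlePoint (chartAt Plane z₀ z₀) r θ)))
            - circlePoint (chartAt Plane z₀ z₀) r θ) n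

/-- The differential `Df(z₀)` of `f` at a fixed point `z₀`, as an endomorphism of the tangent
space at `z₀`. Mathlib gives `Df(z₀)` values in the tangent space at `f z₀`; all tangent spaces
are copies of `ℝ²` (`TangentSpace (𝓡 2) z` is read in the preferred chart at `z`), and since the
points `z₀` and `f z₀` are the same, so are the charts in which source and target are read. -/
def differentialAtFixedPoint (f : M → M) (z₀ : M) : Module.End ℝ Plane :=
  ContinuousLinearMap.toLinearMap (mfderiv (𝓡 2) (𝓡 2) f z₀ : Plane →L[ℝ] Plane)

/-- The fixed point `z₀` of `f` is a saddle-node: one of the two eigenvalues of `Df(z₀)` is `1`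
and the other one is not. -/
def IsSaddleNode (f : M → M) (z₀ : M) : Prop :=
  f z₀ = z₀ ∧ (differentialAtFixedPoint f z₀).HasEigenvalue 1 ∧
    ∃ μ : ℝ, μ ≠ 1 ∧ (differentialAtFixedPoint f z₀).HasEigenvalue μ

/-- The fixed point `z₀` of `f` is trivializable: there is a continuous chart `h : U → V ⊆ ℝ²`
at `z₀` such that `p₁ (h (f z)) > p₁ (h z)` for all `z ∈ U ∩ f⁻¹(U)` with `z ≠ z₀`. -/
def IsTrivializable {N : Type*} [TopologicalSpace N] (f : N → N) (z₀ : N) : Prop :=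
  f z₀ = z₀ ∧
    ∃ h : OpenPartialHomeomorph N Plane, z₀ ∈ h.source ∧
      ∀ z ∈ h.source ∩ f ⁻¹' h.source, z ≠ z₀ → h z 0 < h (f z) 0

end Surface

end

/-!
Let `F` be the expression of `f` in the chart at `z₀`, let `c` be the coordinate of `z₀`, and let
`k`, `l` be linear functionals dual to the eigenvectors of `DF(c)` for the eigenvalues `1` and `μ`
(`exists_dual_eigenfunctionals`). The displacement `F w - w` has the components
`v = k (F w - w)`, with zero derivative at `c`, and `u = l (F w - w)`, whose derivative `(μ - 1) l`
is not zero. By the inverse function theorem `(k (w - c), u)` are local coordinates at `c`, and in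
them `v = g (k (w - c)) + o(1) u`, where `g` is the restriction of `v` to the curve `u = 0`
(`exists_displacement_chart`). Fixed points are the zeros of `(v, u)`, so `g` vanishes only at `0`.

Either `g` has a constant sign `σ` off `0`, or it changes sign there (`exists_eventually_sign`). The
index excludes the second case: on a small circle, `u` has opposite signs at the two points where
`k (w - c) = 0`. A closed loop of arguments of the displacement therefore takes on both half circles
between these points one and the same value `y` for which the direction of angle `y` is in the
kernel of `l`. There `u = 0` and `v` has the same sign at the two points, whereas a change of sign
of `g` would make the signs opposite (`not_hasWindingNumber_zero`).

In the first case strict differentiability gives `u ∘ F = μ u + o(1) (|v| + |u|)`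
(`exists_displacement_bound`). Hence `σ k (w - c) - |u|` if `|μ| < 1`, and `σ k (w - c) + |u|` if
`|μ| > 1`, increases along `F`: up to small errors its increment is `|g| + |1 - |μ|| |u|`
(`lyapunov_increment`). With `u` as second coordinate it forms a continuous chart. Only the first
derivative of `f` is used in the estimates, and a topological chart may involve `|u|`.
-/

/-! ### Linear algebra of the differential -/

/-- The coordinates with respect to a basis of eigenvectors are left eigenvectors. -/
theorem exists_dual_eigenfunctionals {T : Module.End ℝ Plane} {μ : ℝ} (hμ : μ ≠ 1)
    (h₁ : T.HasEigenvalue 1) (h₂ : T.HasEigenvalue μ) :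
    ∃ k l : Plane →L[ℝ] ℝ, (∀ w, k (T w) = k w) ∧ (∀ w, l (T w) = μ * l w) ∧
      ∀ w, k w = 0 → l w = 0 → w = 0 := by
  obtain ⟨e₁, he₁⟩ := h₁.exists_hasEigenvector
  obtain ⟨e₂, he₂⟩ := h₂.exists_hasEigenvector
  have hli : LinearIndependent ℝ ![e₁, e₂] := by
    refine Module.End.eigenvectors_linearIndependent' T ![1, μ] ?_ ![e₁, e₂] ?_
    · intro i j hij
      fin_cases i <;> fin_cases j <;> simp_all
    · intro i
      fin_cases i <;> simpa
  let b := basisOfLinearIndependentOfCardEqFinrank hli (by simp)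
  have hb0 : b 0 = e₁ := by simp [b]
  have hb1 : b 1 = e₂ := by simp [b]
  have hT : ∀ w, T w = b.repr w 0 • b 0 + (μ * b.repr w 1) • b 1 := by
    intro w
    conv_lhs => rw [← b.sum_repr w]
    rw [Fin.sum_univ_two, map_add, map_smul, map_smul, hb0, hb1, he₁.apply_eq_smul,
      he₂.apply_eq_smul, one_smul, smul_smul, mul_comm]
  refine ⟨LinearMap.toContinuousLinearMap (b.coord 0),
    LinearMap.toContinuousLinearMap (b.coord 1), fun w => ?_, fun w => ?_, fun w h0 h1 => ?_⟩
  · simp [hT w]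
  · simp [hT w]
  · rw [← b.sum_repr w, Fin.sum_univ_two]
    simp only [LinearMap.coe_toContinuousLinearMap', Module.Basis.coord_apply] at h0 h1
    simp [h0, h1]

theorem exists_norm_le {k l : Plane →L[ℝ] ℝ} (hkl : ∀ w, k w = 0 → l w = 0 → w = 0) :
    ∃ C : ℝ, 0 < C ∧ ∀ w, ‖w‖ ≤ C * (|k w| + |l w|) := by
  obtain ⟨K, hK, h⟩ := LinearMap.exists_antilipschitzWith
    ((k.prod l : Plane →L[ℝ] ℝ × ℝ) : Plane →ₗ[ℝ] ℝ × ℝ) (by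
      rw [LinearMap.ker_eq_bot']
      intro w hw
      have := Prod.ext_iff.1 hw
      exact hkl w this.1 this.2)
  refine ⟨K, hK, fun w => ?_⟩
  have h1 := h.le_mul_dist w 0
  rw [dist_zero_right, map_zero, dist_zero_right] at h1
  refine h1.trans (mul_le_mul_of_nonneg_left ?_ hK.le)
  change ‖(k w, l w)‖ ≤ _
  rw [Prod.norm_def, Real.norm_eq_abs, Real.norm_eq_abs]
  exact max_le (by simp) (by simp)

theorem map_unitVector_add (k : Plane →L[ℝ] ℝ) (α φ : ℝ) :
    k !₂[Real.cos (α + φ), Real.sin (α + φ)] =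
      Real.cos φ * k !₂[Real.cos α, Real.sin α] +
        Real.sin φ * k !₂[-Real.sin α, Real.cos α] := by
  rw [← smul_eq_mul, ← smul_eq_mul, ← map_smul, ← map_smul, ← map_add]
  congr 1
  ext i
  fin_cases i <;> simp [Real.cos_add, Real.sin_add] <;> ring

/-! ### Loops of winding number zero -/

/-- A loop has nonzero winding number if, along the unit circle, its `l`-component has opposite
signs at the two points where `k` vanishes, and, wherever its `l`-component vanishes, its
`k`-component has the sign of `k` or, for negative `s`, the opposite one. -/
theorem not_hasWindingNumber_zero {k l : Plane →L[ℝ] ℝ} {γ : ℝ → Plane} {s s' : ℝ}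
    (h₁ : ∀ θ, l (γ θ) = 0 → 0 < s * k (γ θ) * k !₂[Real.cos θ, Real.sin θ])
    (h₂ : ∀ θ, k !₂[Real.cos θ, Real.sin θ] = 0 →
      0 < s' * l (γ θ) * l !₂[Real.cos θ, Real.sin θ]) :
    ¬ HasWindingNumber γ 0 := by
  rintro ⟨-, -, a, ha, hγ, hper⟩
  replace hper : a (2 * Real.pi) = a 0 := by simpa using hper
  have hπ := Real.pi_pos
  have hp : Continuous fun θ : ℝ => (!₂[Real.cos θ, Real.sin θ] : Plane) := by fun_prop
  have hneg : ∀ (m : Plane →L[ℝ] ℝ) (θ : ℝ), m !₂[Real.cos (θ + Real.pi), Real.sin (θ + Real.pi)]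
      = - m !₂[Real.cos θ, Real.sin θ] := fun m θ => by
    rw [map_unitVector_add, Real.cos_pi, Real.sin_pi]
    ring
  obtain ⟨α, ⟨hα0, hαπ⟩, hα⟩ : ∃ α ∈ Set.Icc 0 Real.pi, k !₂[Real.cos α, Real.sin α] = 0 := by
    have h := intermediate_value_uIcc (a := 0) (b := Real.pi)
      (k.continuous.comp hp).continuousOn
    have h0 : (0 : ℝ) ∈ Set.uIcc (k !₂[Real.cos 0, Real.sin 0])
        (k !₂[Real.cos Real.pi, Real.sin Real.pi]) := by
      have := hneg k 0
      rw [zero_add] at this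
      rw [this, Set.mem_uIcc]
      rcases le_total (k !₂[Real.cos 0, Real.sin 0]) 0 with h | h
      · left; constructor <;> linarith
      · right; constructor <;> linarith
    obtain ⟨α, hα, h⟩ := h h0
    exact ⟨α, by rwa [Set.uIcc_of_le hπ.le] at hα, h⟩
  have hlγ : ∀ (m : Plane →L[ℝ] ℝ) θ,
      m (γ θ) = ‖γ θ‖ * m !₂[Real.cos (a θ), Real.sin (a θ)] := fun m θ => by
    conv_lhs => rw [hγ θ]
    simp
  set c := k !₂[-Real.sin α, Real.cos α] with hc
  have hk : ∀ θ, k !₂[Real.cos θ, Real.sin θ] = Real.sin (θ - α) * c := fun θ => by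
    have := map_unitVector_add k α (θ - α)
    rw [add_sub_cancel, hα] at this
    simpa using this
  -- At the angles `α` and `α + π` the functional `l` takes values of opposite signs on `γ`,
  -- hence it vanishes on a unit vector whose angle `y` lies between `a α` and `a (α + π)`.
  obtain ⟨y, hy, hly⟩ : ∃ y ∈ Set.uIcc (a α) (a (α + Real.pi)),
      l !₂[Real.cos y, Real.sin y] = 0 := by
    have h := intermediate_value_uIcc (a := a α) (b := a (α + Real.pi))
      (l.continuous.comp hp).continuousOn
    apply h
    have e1 := h₂ α hα
    have e2 := h₂ (α + Real.pi) (by rw [hneg, hα, neg_zero])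
    rw [hneg, hlγ l] at e2
    rw [hlγ l] at e1
    set A := l !₂[Real.cos (a α), Real.sin (a α)]
    set B := l !₂[Real.cos (a (α + Real.pi)), Real.sin (a (α + Real.pi))]
    set q := s' * l !₂[Real.cos α, Real.sin α]
    have e1' : 0 < ‖γ α‖ * (A * q) := by convert e1 using 1; ring
    have e2' : 0 < ‖γ (α + Real.pi)‖ * (-(B * q)) := by convert e2 using 1; ring
    have e1'' := pos_of_mul_pos_right e1' (norm_nonneg _)
    have e2'' := pos_of_mul_pos_right e2' (norm_nonneg _)
    change (0 : ℝ) ∈ Set.uIcc A B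
    rw [Set.mem_uIcc]
    rcases le_total q 0 with h | h
    · left; constructor <;> nlinarith
    · right; constructor <;> nlinarith
  have key : ∀ θ, a θ = y →
      0 < ‖γ θ‖ * (s * k !₂[Real.cos y, Real.sin y] * c) * Real.sin (θ - α) := by
    intro θ hθ
    have := h₁ θ (by rw [hlγ, hθ, hly, mul_zero])
    rw [hlγ, hθ, hk θ] at this
    convert this using 1
    ring
  -- The angle `y` is attained on each of the two half circles bounded by the angles `α`, `α + π`.
  obtain ⟨t, ht, hty⟩ : ∃ t ∈ Set.uIcc α (α + Real.pi), a t = y :=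
    intermediate_value_uIcc ha.continuousOn hy
  rw [Set.uIcc_of_le (by linarith)] at ht
  -- The second half circle is cut at the angle `0`, where the two ends of the determination agree.
  obtain ⟨t', ht', hty'⟩ : ∃ t', Real.sin (t' - α) ≤ 0 ∧ a t' = y := by
    rcases Set.uIcc_subset_uIcc_union_uIcc (b := a 0) hy with h | h
    · obtain ⟨t', h, h'⟩ := intermediate_value_uIcc ha.continuousOn h
      rw [Set.uIcc_of_ge hα0] at h
      exact ⟨t', Real.sin_nonpos_of_nonpos_of_neg_pi_le (by linarith [h.2]) (by linarith [h.1]), h'⟩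
    · rw [← hper] at h
      obtain ⟨t', h, h'⟩ := intermediate_value_uIcc ha.continuousOn h
      rw [Set.uIcc_of_ge (by linarith)] at h
      refine ⟨t', ?_, h'⟩
      rw [← Real.sin_sub_two_pi]
      exact Real.sin_nonpos_of_nonpos_of_neg_pi_le (by linarith [h.2]) (by linarith [h.1])
  have hs : 0 ≤ Real.sin (t - α) :=
    Real.sin_nonneg_of_nonneg_of_le_pi (by linarith [ht.1]) (by linarith [ht.2])
  have k1 := key t hty
  have k2 := key t' hty'
  have p1 := pos_of_mul_pos_left k1 hs
  have p2 := pos_of_mul_pos_right p1 (norm_nonneg _)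
  exact absurd k2 (not_lt.2 (mul_nonpos_of_nonneg_of_nonpos
    (mul_nonneg (norm_nonneg _) p2.le) ht'))

/-! ### The sign of a function near an isolated zero -/

theorem exists_eventually_sign {g : ℝ → ℝ} (hg : ∃ t ∈ 𝓝 (0 : ℝ), ContinuousOn g t)
    (hne : ∀ᶠ x in 𝓝[≠] (0 : ℝ), g x ≠ 0) :
    (∃ σ : ℝ, |σ| = 1 ∧ ∀ᶠ x in 𝓝[≠] (0 : ℝ), 0 < σ * g x) ∨
      ∃ s : ℝ, ∀ᶠ x in 𝓝[≠] (0 : ℝ), 0 < s * g x * x := by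
  obtain ⟨t, ht, hg⟩ := hg
  rw [eventually_nhdsWithin_iff] at hne
  obtain ⟨δ, hδ, hball⟩ := Metric.eventually_nhds_iff_ball.1 (hne.and ht)
  simp only [Real.ball_eq_Ioo, zero_sub, zero_add, Set.mem_Ioo] at hball
  have hsame : ∀ x y, -δ < x → x < δ → -δ < y → y < δ → 0 < x * y → 0 < g x * g y := by
    intro x y hx1 hx2 hy1 hy2 hxy
    have hord : ∀ z ∈ Set.uIcc x y, (-δ < z ∧ z < δ) ∧ z ≠ 0 := by
      intro z hz
      rw [Set.mem_uIcc] at hz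
      refine ⟨by rcases hz with h | h <;> constructor <;> linarith, ?_⟩
      rintro rfl
      rcases hz with h | h <;> nlinarith
    by_contra hcon
    have h0 : (0 : ℝ) ∈ Set.uIcc (g x) (g y) := by
      rw [Set.mem_uIcc]
      rcases le_total (g x) 0 with h | h <;> rcases le_total (g y) 0 with h' | h'
      · rcases mul_nonneg_of_nonpos_of_nonpos h h' |>.eq_or_lt with h'' | h''
        · rcases mul_eq_zero.1 h''.symm with e | e <;> simp [e, h, h']
        · exact absurd h'' hcon
      · exact Or.inl ⟨h, h'⟩
      · exact Or.inr ⟨h', h⟩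
      · rcases mul_nonneg h h' |>.eq_or_lt with h'' | h''
        · rcases mul_eq_zero.1 h''.symm with e | e <;> simp [e, h, h']
        · exact absurd h'' hcon
    obtain ⟨z, hz, hz0⟩ := intermediate_value_uIcc
      (hg.mono fun z hz => (hball z (hord z hz).1).2) h0
    exact (hball z (hord z hz).1).1 (hord z hz).2 hz0
  set p := g (δ / 2)
  set q := g (-(δ / 2))
  have hp : p ≠ 0 := (hball (δ / 2) ⟨by linarith, by linarith⟩).1 (by simp; positivity)
  have hq : q ≠ 0 := (hball (-(δ / 2)) ⟨by linarith, by linarith⟩).1 (by simp; positivity)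
  have hpos : ∀ x, 0 < x → x < δ → 0 < p * g x := fun x h0 h1 =>
    hsame _ _ (by linarith) (by linarith) (by linarith) h1 (by positivity)
  have hneg : ∀ x, x < 0 → -δ < x → 0 < q * g x := fun x h0 h1 =>
    hsame _ _ (by linarith) (by linarith) h1 (by linarith) (by nlinarith)
  have hev : ∀ᶠ x in 𝓝[≠] (0 : ℝ), x ≠ 0 ∧ -δ < x ∧ x < δ :=
    eventually_mem_nhdsWithin.and
      (nhdsWithin_le_nhds (Ioo_mem_nhds (neg_lt_zero.2 hδ) hδ))
  rcases lt_or_gt_of_ne (mul_ne_zero hp hq) with hpq | hpq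
  · refine Or.inr ⟨p, hev.mono fun x ⟨h0, h1, h2⟩ => ?_⟩
    rcases lt_or_gt_of_ne h0 with h | h
    · have := hneg x h h1
      have h3 : p * g x < 0 := by
        by_contra hc
        nlinarith [mul_nonneg (not_lt.1 hc) this.le, mul_self_pos.2 (right_ne_zero_of_mul this.ne')]
      exact mul_pos_of_neg_of_neg h3 h
    · exact mul_pos (hpos x h h2) h
  · refine Or.inl ⟨p / |p|, by rw [abs_div, abs_abs, div_self (abs_ne_zero.2 hp)],
      hev.mono fun x ⟨h0, h1, h2⟩ => ?_⟩
    rw [div_mul_eq_mul_div]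
    refine div_pos ?_ (abs_pos.2 hp)
    rcases lt_or_gt_of_ne h0 with h | h
    · have := hneg x h h1
      by_contra hc
      nlinarith [mul_pos hpq this, mul_self_pos.2 hq]
    · exact hpos x h h2

/-! ### The displacement of a planar map near a fixed point -/

/-- The sign conditions of `not_hasWindingNumber_zero`, imposed near `c` on the displacement
`F w - w`, exclude the index `0`. -/
theorem eventually_not_hasWindingNumber_zero {k l : Plane →L[ℝ] ℝ}
    {F : Plane → Plane} {c : Plane} {s s' : ℝ}
    (h₁ : ∀ᶠ w in 𝓝[≠] c, l (F w - w) = 0 → 0 < s * k (F w - w) * k (w - c))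
    (h₂ : ∀ᶠ w in 𝓝[≠] c, k (w - c) = 0 → 0 < s' * l (F w - w) * l (w - c)) :
    ∀ᶠ r : ℝ in 𝓝[>] 0,
      ¬ HasWindingNumber (fun θ => F (circlePoint c r θ) - circlePoint c r θ) 0 := by
  have h := h₁.and h₂
  rw [eventually_nhdsWithin_iff] at h
  obtain ⟨δ, hδ, hball⟩ := Metric.eventually_nhds_iff_ball.1 h
  filter_upwards [Ioo_mem_nhdsGT hδ] with r hr
  have hnorm : ∀ θ : ℝ, ‖(!₂[Real.cos θ, Real.sin θ] : Plane)‖ = 1 := fun θ => by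
    simp [EuclideanSpace.norm_eq, Fin.sum_univ_two]
  have hsub : ∀ θ, circlePoint c r θ - c = r • !₂[Real.cos θ, Real.sin θ] := fun θ => by
    simp [circlePoint]
  have hmem : ∀ θ, circlePoint c r θ ∈ Metric.ball c δ ∧ circlePoint c r θ ≠ c := fun θ => by
    have : ‖circlePoint c r θ - c‖ = r := by
      rw [hsub, norm_smul, hnorm, mul_one, Real.norm_of_nonneg hr.1.le]
    refine ⟨by rw [mem_ball_iff_norm, this]; exact hr.2, fun h => hr.1.ne ?_⟩
    rw [← this, h, sub_self, norm_zero]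
  refine not_hasWindingNumber_zero (k := k) (l := l) (s := s) (s' := s') ?_ ?_
  · intro θ h0
    have := (hball _ (hmem θ).1 (hmem θ).2).1 h0
    rw [hsub, map_smul, smul_eq_mul, mul_left_comm] at this
    exact pos_of_mul_pos_right this hr.1.le
  · intro θ h0
    have := (hball _ (hmem θ).1 (hmem θ).2).2 (by rw [hsub, map_smul, h0, smul_zero])
    rw [hsub, map_smul, smul_eq_mul, mul_left_comm] at this
    exact pos_of_mul_pos_right this hr.1.le

section Planar

variable {F : Plane → Plane} {c : Plane} {T : Plane →L[ℝ] Plane} {μ : ℝ} {k l : Plane →L[ℝ] ℝ}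

/-- The component of the displacement along a left eigenvector of the differential, for the
eigenvalue `ν`, has derivative `(ν - 1) m`. -/
theorem hasStrictFDerivAt_displacement (hF : HasStrictFDerivAt F T c) {m : Plane →L[ℝ] ℝ} {ν : ℝ}
    (hm : ∀ w, m (T w) = ν * m w) :
    HasStrictFDerivAt (fun w => m (F w - w)) ((ν - 1) • m) c := by
  have := m.hasStrictFDerivAt.comp c (hF.sub (hasStrictFDerivAt_id c))
  refine this.congr_fderiv ?_
  ext w
  simp [hm, sub_mul]

/-- The functions `k (w - c)` and `l (F w - w)` are local coordinates at `c`. The component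
`k (F w - w)` has zero derivative at `c`, so it differs from its value `g` at the point with the same
first coordinate on the curve `l (F w - w) = 0` by a small multiple of the second coordinate. -/
theorem exists_displacement_chart (hF : HasStrictFDerivAt F T c) (hFc : F c = c)
    (hiso : ∀ᶠ w in 𝓝[≠] c, F w ≠ w) (hk : ∀ w, k (T w) = k w) (hl : ∀ w, l (T w) = μ * l w)
    (hkl : ∀ w, k w = 0 → l w = 0 → w = 0) (hμ : μ ≠ 1) :
    ∃ Q : OpenPartialHomeomorph Plane (ℝ × ℝ), c ∈ Q.source ∧
      (∀ w, Q w = (k (w - c), l (F w - w))) ∧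
      ∃ g : ℝ → ℝ, g 0 = 0 ∧ (∃ t ∈ 𝓝 (0 : ℝ), ContinuousOn g t) ∧
        (∀ᶠ x in 𝓝[≠] (0 : ℝ), g x ≠ 0) ∧
        ∀ ε > 0, ∀ᶠ w in 𝓝 c,
          |k (F w - w) - g (k (w - c))| ≤ ε * |l (F w - w)| := by
  have hμ' : μ - 1 ≠ 0 := sub_ne_zero.2 hμ
  have hu := hasStrictFDerivAt_displacement hF hl
  have hv : HasStrictFDerivAt (fun w => k (F w - w)) (0 : Plane →L[ℝ] ℝ) c := by
    simpa using hasStrictFDerivAt_displacement (ν := 1) hF (m := k) (by simpa using hk)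
  have hinj : LinearMap.ker ((k.prod ((μ - 1) • l) : Plane →L[ℝ] ℝ × ℝ) :
      Plane →ₗ[ℝ] ℝ × ℝ) = ⊥ := by
    rw [LinearMap.ker_eq_bot']
    intro w hw
    have h := Prod.ext_iff.1 hw
    exact hkl w h.1 ((mul_eq_zero.1 h.2).resolve_left hμ')
  let A : Plane ≃L[ℝ] ℝ × ℝ :=
    (LinearMap.linearEquivOfInjective _ (LinearMap.ker_eq_bot.1 hinj)
      (by simp)).toContinuousLinearEquiv
  have hΦ : HasStrictFDerivAt (fun w => (k (w - c), l (F w - w))) (A : Plane →L[ℝ] ℝ × ℝ) c := by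
    have h := (k.hasStrictFDerivAt.comp c
      ((hasStrictFDerivAt_id c).sub_const c)).prodMk hu
    exact h.congr_fderiv (ContinuousLinearMap.ext fun w => rfl)
  set Q := hΦ.toOpenPartialHomeomorph _ with hQ
  have hcQ : c ∈ Q.source := hΦ.mem_toOpenPartialHomeomorph_source
  have hQw : ∀ w, Q w = (k (w - c), l (F w - w)) := fun w => rfl
  have hQc : Q c = (0, 0) := by simp [hQw, hFc]
  have hQ0 : Q.symm (0, 0) = c := by rw [← hQc, Q.left_inv hcQ]
  have hQs : HasStrictFDerivAt Q.symm (A.symm : ℝ × ℝ →L[ℝ] Plane) (0, 0) := by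
    have := hΦ.to_localInverse
    rw [show (k (c - c), l (F c - c)) = ((0, 0) : ℝ × ℝ) from hQc] at this
    exact this
  have hG : HasStrictFDerivAt (fun p => k (F (Q.symm p) - Q.symm p)) (0 : ℝ × ℝ →L[ℝ] ℝ) (0, 0) := by
    have := HasStrictFDerivAt.comp (f := Q.symm) (0, 0) (by rw [hQ0]; exact hv) hQs
    simpa using this
  have hcont : Continuous fun x : ℝ => (x, (0 : ℝ)) := by fun_prop
  have hten : Filter.Tendsto (fun x : ℝ => (x, (0 : ℝ))) (𝓝 0) (𝓝 (0, 0)) := hcont.tendsto 0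
  refine ⟨Q, hcQ, hQw, fun x => k (F (Q.symm (x, 0)) - Q.symm (x, 0)), ?_, ?_, ?_, ?_⟩
  · simp [hQ0, hFc]
  · obtain ⟨K, s, hs, hlip⟩ := hG.exists_lipschitzOnWith
    exact ⟨_, hten hs, hlip.continuousOn.comp hcont.continuousOn fun x hx => hx⟩
  · rw [eventually_nhdsWithin_iff] at hiso ⊢
    have htar : ∀ᶠ p in 𝓝 ((0, 0) : ℝ × ℝ), p ∈ Q.target := by
      rw [← hQc]; exact Q.open_target.mem_nhds (Q.map_source hcQ)
    have hback : Filter.Tendsto Q.symm (𝓝 (0, 0)) (𝓝 c) := by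
      have := hQs.continuousAt.tendsto
      rwa [hQ0] at this
    filter_upwards [hten.eventually htar, (hback.comp hten).eventually hiso] with x hx hne hx0 h0
    have hr : (k (Q.symm (x, 0) - c), l (F (Q.symm (x, 0)) - Q.symm (x, 0))) = (x, 0) := by
      rw [← hQw, Q.right_inv hx]
    rw [Prod.mk.injEq] at hr
    have hfix : F (Q.symm (x, 0)) = Q.symm (x, 0) := sub_eq_zero.1 (hkl _ h0 hr.2)
    refine hx0 ?_
    by_contra hx0'
    refine hne (fun hc => hx0' ?_) hfix
    change Q.symm (x, 0) = c at hc
    rw [← hr.1, hc, sub_self, map_zero]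
    rfl
  · intro ε hε
    have hQt : Filter.Tendsto Q (𝓝 c) (𝓝 (0, 0)) := by
      have := (Q.continuousAt hcQ).tendsto
      rwa [hQc] at this
    have hpair : Filter.Tendsto (fun w => (Q w, ((Q w).1, (0 : ℝ)))) (𝓝 c)
        (𝓝 (((0, 0) : ℝ × ℝ), ((0, 0) : ℝ × ℝ))) :=
      hQt.prodMk_nhds (hten.comp ((continuous_fst.tendsto ((0, 0) : ℝ × ℝ)).comp hQt))
    filter_upwards [hpair.eventually (hG.isLittleO.def hε), Q.open_source.mem_nhds hcQ]
      with w hw hws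
    rw [Q.left_inv hws, zero_apply, sub_zero, hQw] at hw
    refine hw.trans_eq ?_
    simp [Prod.norm_def]

/-- Strict differentiability, applied to the pair of points `F w` and `w`, shows that the component
`l (F w - w)` of the displacement is multiplied approximately by `μ` when `w` is replaced by
`F w`. -/
theorem exists_displacement_bound (hF : HasStrictFDerivAt F T c) (hFc : F c = c)
    (hl : ∀ w, l (T w) = μ * l w)
    (hkl : ∀ w, k w = 0 → l w = 0 → w = 0) {ε : ℝ} (hε : 0 < ε) :
    ∀ᶠ w in 𝓝 c, |l (F (F w) - F w) - μ * l (F w - w)| ≤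
        ε * (|k (F w - w)| + |l (F w - w)|) := by
  obtain ⟨C, hC, hCw⟩ := exists_norm_le hkl
  have hFt : Filter.Tendsto F (𝓝 c) (𝓝 c) := by
    have := hF.continuousAt.tendsto
    rwa [hFc] at this
  have hpair : Filter.Tendsto (fun w => (F w, w)) (𝓝 c) (𝓝 (c, c)) :=
    hFt.prodMk_nhds Filter.tendsto_id
  filter_upwards [hpair.eventually
    ((hasStrictFDerivAt_displacement hF hl).isLittleO.def (div_pos hε hC))] with w hw
  have h1 := hCw (F w - w)
  calc _ = ‖l (F (F w) - F w) - l (F w - w) - ((μ - 1) • l) (F w - w)‖ := by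
        rw [Real.norm_eq_abs]; congr 1; simp; ring
    _ ≤ ε / C * ‖F w - w‖ := hw
    _ ≤ ε / C * (C * (|k (F w - w)| + |l (F w - w)|)) := by gcongr
    _ = _ := by field_simp

/-- On the line `k = 0` through `c`, the component `l (F w - w)` has the sign of its linear part
`(μ - 1) l (w - c)`. -/
theorem eventually_transverse_sign (hF : HasStrictFDerivAt F T c) (hFc : F c = c)
    (hl : ∀ w, l (T w) = μ * l w)
    (hkl : ∀ w, k w = 0 → l w = 0 → w = 0) (hμ : μ ≠ 1) :
    ∀ᶠ w in 𝓝[≠] c, k (w - c) = 0 → 0 < (μ - 1) * l (F w - w) * l (w - c) := by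
  obtain ⟨C, hC, hCw⟩ := exists_norm_le hkl
  have hμ' : 0 < |μ - 1| := abs_pos.2 (sub_ne_zero.2 hμ)
  have h := (hasStrictFDerivAt_displacement hF hl).hasFDerivAt.isLittleO.def
    (c := |μ - 1| / (2 * C)) (by positivity)
  rw [eventually_nhdsWithin_iff]
  filter_upwards [h] with w hw hwc hk0
  have hl0 : l (w - c) ≠ 0 := fun hl0 => hwc (sub_eq_zero.1 (hkl _ hk0 hl0))
  have h1 := hCw (w - c)
  rw [hk0, abs_zero, zero_add] at h1
  have h2 : |l (F w - w) - (μ - 1) * l (w - c)| ≤ |μ - 1| / 2 * |l (w - c)| := by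
    calc _ = ‖l (F w - w) - l (F c - c) - ((μ - 1) • l) (w - c)‖ := by
          rw [Real.norm_eq_abs]; congr 1; simp [hFc]
      _ ≤ |μ - 1| / (2 * C) * ‖w - c‖ := hw
      _ ≤ |μ - 1| / (2 * C) * (C * |l (w - c)|) := by gcongr
      _ = _ := by field_simp
  set X := (μ - 1) * l (w - c) with hX
  have hXabs : |μ - 1| / 2 * |l (w - c)| = |X| / 2 := by rw [hX, abs_mul]; ring
  have hX0 : X ≠ 0 := mul_ne_zero (sub_ne_zero.2 hμ) hl0
  rw [hXabs] at h2
  have : (μ - 1) * l (F w - w) * l (w - c) = l (F w - w) * X := by rw [hX]; ring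
  rw [this]
  obtain ⟨h3, h4⟩ := abs_le.1 h2
  rcases lt_or_gt_of_ne hX0 with h | h
  · rw [abs_of_neg h] at h3 h4; exact mul_pos_of_neg_of_neg (by linarith) h
  · rw [abs_of_pos h] at h3 h4; exact mul_pos (by linarith) h

/-! ### A coordinate that increases along the map -/

/-- The homeomorphism `(x, u) ↦ (σ x + τ |u|, u)`. -/
def shearAbs (σ τ : ℝ) (hσ : |σ| = 1) : ℝ × ℝ ≃ₜ Plane where
  toFun p := !₂[σ * p.1 + τ * |p.2|, p.2]
  invFun w := (σ * (w 0 - τ * |w 1|), w 1)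
  left_inv p := by
    have : σ * σ = 1 := by rw [← abs_mul_abs_self, hσ, one_mul]
    ext <;> simp [← mul_assoc, this]
  right_inv w := by
    have : σ * σ = 1 := by rw [← abs_mul_abs_self, hσ, one_mul]
    ext i
    fin_cases i <;> simp [← mul_assoc, this]
  continuous_toFun := by fun_prop
  continuous_invFun := by fun_prop

/-- The numerical estimate behind the increasing coordinate. Here `u`, `u'` are the values of the
`l`-component of the displacement at a point and at its image, and `v` is the `k`-component, so that
`σ v ∓ (|u'| - |u|)` is the increment of `σ k ∓ |u|`. -/
theorem lyapunov_increment {σ μ g v u u' ε D : ℝ} (hσ : |σ| = 1) (hD : 0 < D) (hε : 0 < ε)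
    (hε1 : ε ≤ 1 / 2) (hεD : 3 * ε ≤ D / 2) (hg : 0 ≤ σ * g) (hgu : σ * g ≠ 0 ∨ u ≠ 0)
    (hv : |v - g| ≤ ε * |u|) (hu : |u' - μ * u| ≤ ε * (|v| + |u|)) :
    (D = 1 - |μ| → 0 < σ * v - (|u'| - |u|)) ∧ (D = |μ| - 1 → 0 < σ * v + (|u'| - |u|)) := by
  have h0 := abs_nonneg u
  have hgabs : |g| = σ * g := by rw [← abs_of_nonneg hg, abs_mul, hσ, one_mul]
  have hv1 : |v| ≤ σ * g + ε * |u| := by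
    have := abs_sub_abs_le_abs_sub v g
    linarith
  have hv2 : σ * g - ε * |u| ≤ σ * v := by
    have h1 : |σ * (v - g)| ≤ ε * |u| := by rwa [abs_mul, hσ, one_mul]
    have := (abs_le.1 h1).1
    linarith
  have hu' : |u' - μ * u| ≤ ε * (σ * g) + 2 * ε * |u| := by
    have h2 : ε * (|v| + |u|) ≤ ε * ((σ * g + 1 * |u|) + |u|) := by
      have : ε * |u| ≤ 1 * |u| := by gcongr; linarith
      gcongr
      linarith
    linarith
  have h1 := (abs_abs_sub_abs_le u' (μ * u)).trans hu'
  rw [abs_mul] at h1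
  obtain ⟨h2, h3⟩ := abs_le.1 h1
  have hpos : 0 < σ * g / 2 + D / 2 * |u| := by
    rcases hgu with h | h
    · have := lt_of_le_of_ne hg h.symm
      positivity
    · have := abs_pos.2 h
      positivity
  constructor <;> rintro rfl <;> nlinarith

/-- A planar fixed point whose differential has the eigenvalues `1` and `μ`, `|μ| ≠ 1`, and whose
index is `0`, is trivializable. -/
theorem exists_increasing_coordinate (hF : HasStrictFDerivAt F T c) (hFc : F c = c)
    (hiso : ∀ᶠ w in 𝓝[≠] c, F w ≠ w) (hk : ∀ w, k (T w) = k w) (hl : ∀ w, l (T w) = μ * l w)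
    (hkl : ∀ w, k w = 0 → l w = 0 → w = 0) (hμ : |μ| ≠ 1)
    (hind : ∀ᶠ r : ℝ in 𝓝[>] 0,
      HasWindingNumber (fun θ => F (circlePoint c r θ) - circlePoint c r θ) 0) :
    ∃ H : OpenPartialHomeomorph Plane Plane, c ∈ H.source ∧
      ∀ w ∈ H.source, w ≠ c → H w 0 < H (F w) 0 := by
  have hμ1 : μ ≠ 1 := by rintro rfl; simp at hμ
  obtain ⟨Q, hcQ, hQ, g, hg0, hgc, hgne, hgε⟩ :=
    exists_displacement_chart hF hFc hiso hk hl hkl hμ1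
  have hinj : ∀ w ∈ Q.source, w ≠ c → k (w - c) = 0 → l (F w - w) ≠ 0 := by
    intro w hw hwc h0 h0'
    exact hwc (Q.injOn hw hcQ (by simp [hQ, h0, h0', hFc]))
  have hkt : Filter.Tendsto (fun w => k (w - c)) (𝓝 c) (𝓝 0) := by
    have : Continuous fun w => k (w - c) := by fun_prop
    simpa using this.tendsto c
  have hsrc := Q.open_source.mem_nhds hcQ
  rcases exists_eventually_sign hgc hgne with ⟨σ, hσ, hsign⟩ | ⟨s, hsign⟩
  swap
  -- If `g` changes sign at `0`, the winding number cannot vanish.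
  · exfalso
    rw [eventually_nhdsWithin_iff] at hsign
    have h1 : ∀ᶠ w in 𝓝[≠] c, l (F w - w) = 0 → 0 < s * k (F w - w) * k (w - c) := by
      rw [eventually_nhdsWithin_iff]
      filter_upwards [hsrc, hgε 1 one_pos, hkt.eventually hsign] with w hw hgw hs hwc h0
      rw [h0, abs_zero, mul_zero, abs_nonpos_iff, sub_eq_zero] at hgw
      rw [hgw]
      exact hs fun hk0 => hinj w hw hwc hk0 h0
    obtain ⟨r, hr, hr'⟩ := (hind.and (eventually_not_hasWindingNumber_zero h1
      (eventually_transverse_sign hF hFc hl hkl hμ1))).exists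
    exact hr' hr
  rw [eventually_nhdsWithin_iff] at hsign
  set D := abs (1 - |μ|) with hD
  have hDpos : 0 < D := abs_pos.2 (sub_ne_zero.2 hμ.symm)
  obtain ⟨τ, hτ⟩ : ∃ τ : ℝ, (τ = -1 ∧ D = 1 - |μ|) ∨ (τ = 1 ∧ D = |μ| - 1) := by
    rcases le_total 0 (1 - |μ|) with h | h
    · exact ⟨-1, Or.inl ⟨rfl, abs_of_nonneg h⟩⟩
    · exact ⟨1, Or.inr ⟨rfl, by rw [hD, abs_of_nonpos h, neg_sub]⟩⟩
  -- The bounds `1 / 2` and `D / 6` let half of `|g|` and of `D |u|` absorb the error terms.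
  set ε := min (1 / 2) (D / 6) with hε
  have hεpos : 0 < ε := by positivity
  have hε1 : ε ≤ 1 / 2 := min_le_left _ _
  have hε2 : ε ≤ D / 6 := min_le_right _ _
  obtain ⟨U, hU, hUo, hcU⟩ := eventually_nhds_iff.1
    (((hgε ε hεpos).and (exists_displacement_bound hF hFc hl hkl hεpos)).and
      (hkt.eventually hsign))
  refine ⟨(Q.restrOpen U hUo).trans (shearAbs σ τ hσ).toOpenPartialHomeomorph, ?_, ?_⟩
  · simp [hcQ, hcU]
  intro w hw hwc
  have hw' : w ∈ Q.source ∧ w ∈ U := by simpa using hw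
  obtain ⟨⟨hv, hu⟩, hs⟩ := hU w hw'.2
  have hsg : 0 ≤ σ * g (k (w - c)) ∧ (σ * g (k (w - c)) ≠ 0 ∨ l (F w - w) ≠ 0) := by
    by_cases hk0 : k (w - c) = 0
    · refine ⟨by rw [hk0, hg0, mul_zero], Or.inr (hinj w hw'.1 hwc hk0)⟩
    · exact ⟨(hs hk0).le, Or.inl (hs hk0).ne'⟩
  have hinc := lyapunov_increment hσ hDpos hεpos hε1 (by linarith) hsg.1 hsg.2 hv hu
  have hH : ∀ z, ((Q.restrOpen U hUo).trans (shearAbs σ τ hσ).toOpenPartialHomeomorph) z 0 =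
      σ * k (z - c) + τ * |l (F z - z)| := fun z => by
    simp [shearAbs, hQ]
  rw [hH, hH]
  have hadd : k (F w - c) = k (F w - w) + k (w - c) := by rw [← map_add, sub_add_sub_cancel]
  rw [hadd]
  rcases hτ with ⟨rfl, h⟩ | ⟨rfl, h⟩
  · linarith [hinc.1 h]
  · linarith [hinc.2 h]

end Planar

/-! ### Saddle-nodes of index zero on surfaces -/

theorem mainTheorem8 {M : Type*} [TopologicalSpace M] [ChartedSpace Plane M]
    [IsManifold (𝓡 2) 2 M] (f : M ≃ₘ^2⟮𝓡 2, 𝓡 2⟯ M) (z₀ : M)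
    (hsaddle : IsSaddleNode f z₀)
    (hneg : ¬ (differentialAtFixedPoint f z₀).HasEigenvalue (-1))
    (hindex : HasLefschetzIndex f z₀ 0) :
    IsTrivializable f z₀ := by
  obtain ⟨hfix, h1, μ, hμ, h2⟩ := hsaddle
  obtain ⟨k, l, hk, hl, hkl⟩ := exists_dual_eigenfunctionals hμ h1 h2
  have habs : |μ| ≠ 1 := by
    intro h
    rcases eq_or_eq_neg_of_abs_eq h with rfl | rfl
    · exact hμ rfl
    · exact hneg h2
  set φ := chartAt Plane z₀ with hφ
  set c := φ z₀ with hc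
  have hz : z₀ ∈ φ.source := mem_chart_source Plane z₀
  have hcz : φ.symm c = z₀ := φ.left_inv hz
  set F : Plane → Plane := fun w => φ (f (φ.symm w)) with hFdef
  have hFc : F c = c := by simp only [hFdef, hcz, hfix, ← hc]
  have hsm : ContMDiffAt (𝓡 2) (𝓡 2) 2 f z₀ := f.contMDiff.contMDiffAt
  have hCD : ContDiffAt ℝ 2 F c := by
    have := (contMDiffAt_iff.1 hsm).2
    rw [hfix] at this
    simpa [Function.comp_def, contDiffWithinAt_univ] using this
  have hT : differentialAtFixedPoint f z₀ = (fderiv ℝ F c : Plane →ₗ[ℝ] Plane) := by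
    have hmd := hsm.mdifferentiableAt (by norm_num)
    have hF' : writtenInExtChartAt (𝓡 2) (𝓡 2) z₀ f = F := by
      ext1 w
      simp [writtenInExtChartAt, hfix, hFdef, hφ]
    have hmf : (mfderiv (𝓡 2) (𝓡 2) f z₀ : Plane →L[ℝ] Plane) = fderiv ℝ F c := by
      rw [hmd.mfderiv, hF']
      simp [fderivWithin_univ, hc, hφ]
      rfl
    exact congrArg ContinuousLinearMap.toLinearMap hmf
  have hF : HasStrictFDerivAt F (fderiv ℝ F c) c := hCD.hasStrictFDerivAt (by norm_num)
  have hiso : ∀ᶠ w in 𝓝[≠] c, F w ≠ w := by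
    have h := hindex.1.2
    rw [eventually_nhdsWithin_iff] at h ⊢
    have ht : Filter.Tendsto φ.symm (𝓝 c) (𝓝 z₀) := φ.tendsto_symm hz
    have hft : Filter.Tendsto (fun w => f (φ.symm w)) (𝓝 c) (𝓝 z₀) := by
      have := f.continuous.tendsto z₀
      rw [hfix] at this
      exact this.comp ht
    filter_upwards [ht.eventually h, hft.eventually (φ.open_source.mem_nhds hz),
      φ.open_target.mem_nhds (φ.map_source hz)] with w h hs ht' hwc hFw
    refine h (fun h0 => hwc ?_) ?_
    · change φ.symm w = z₀ at h0
      change w = c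
      rw [hc, ← h0, φ.right_inv ht']
    · rw [← φ.left_inv hs]
      exact congrArg φ.symm hFw
  rw [hT] at hk hl
  obtain ⟨H, hcH, hH⟩ := exists_increasing_coordinate hF hFc hiso hk hl hkl habs hindex.2
  refine ⟨hfix, φ.trans H, by simp [hz, ← hc, hcH], ?_⟩
  rintro z ⟨hz1, hz2⟩ hne
  rw [OpenPartialHomeomorph.trans_source] at hz1
  have := hH (φ z) hz1.2 (fun h => hne (φ.injOn hz1.1 hz h))
  simpa [hFdef, φ.left_inv hz1.1] using this
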